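/- Notation. Write a quaternion as $q=z_1+z_2\mathbf j$ with $z_1,z_2\in\mathbb C$, and identify $\mathbb H\cong\mathbb C^2\cong\mathbb R^4$. Let $\mathcal D=\frac12\left(\frac{\partial}{\partial\bar z_1}+\mathbf j\,\frac{\partial}{\partial\bar z_2}\right)$ act on $C^\infty$ functions with values in $\mathbb H$. Definitions. Let $U\subset\mathbb H$ be open. - A function $f:U\to\mathbb H$ is hyperholomorphic on $U$ if it is $C^\infty$ and $\mathcal Df=0$ on $U$. - An exceptional subset of $U$ is a subset $S\subset U$, closed in $U$, that is contained in the union of a family of $C^\infty$ real hypersurfaces which is locally finite in $U$. A function is defined almost everywhere on $U$ if it is defined outside an exceptional subset. - An almost everywhere defined function $f$ is w-hypermeromorphic on $U$ if, for some exceptional subset $S$ of $U$, $f$ is hyperholomorphic on $U\setminus S$ and $q\mapsto f(q)^{-1}$ is hyperholomorphic on $\{q\in U\setminus S: f(q)\neq0\}$. - $f$ is hypermeromorphic on $U$ if it belongs to a set of w-hypermeromorphic functions on $U$ that is closed under sums and products. - $f$ is pseudoholomorphic on $U$ if it is hypermeromorphic and has no poles on $U$, i.e. it is hyperholomorphic on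 the whole of $U$. It is a sha function on $U$ if, moreover, it has no zeroes on $U$. - A Hamilton 4-manifold is a Hausdorff topological space $X$ with an atlas of charts $h:U\to\mathbb H$ (homeomorphisms of open subsets of $X$ onto open subsets of $\mathbb H$) such that, for any two distinct charts $(h,U)\neq(h',U')$ of the atlas, the transition function $h'\circ h^{-1}:h(U\cap U')\to\mathbb H$ is a sha function. The pseudoholomorphic charts of $X$ are the charts of the atlas and their restrictions to open subsets. - A map $f:X\to Y$ of Hamilton 4-manifolds is a morphism if it is continuous and, for every pair of pseudoholomorphic charts $(h,U)$ of $X$ and $(k,V)$ of $Y$ with $f(U)\subset V$, the function $k\circ f\circ h^{-1}:h(U)\to k(V)$ is pseudoholomorphic on $h(U)$. Theorem (Identity theorem). Let $X$ and $Y$ be Hamilton 4-manifolds with $X$ connected, and let $f_1,f_2:X\to Y$ be two morphisms which coincide on a neighbourhood of some point $x_0\in X$. Then $f_1=f_2$ on all of $X$. -/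

import Mathlib

open Set Filter Topology
open scoped Quaternion ContDiff Manifold

/-! Quaternions are written `q = z₁ + z₂ j` with `z₁ = q.re + q.imI i` and
`z₂ = q.imJ + q.imK i`. -/

noncomputable section

namespace Hamilton

/-- The quaternionic unit `i`. -/
def unitI : ℍ[ℝ] := ⟨0, 1, 0, 0⟩

/-- The quaternionic unit `j`. -/
def unitJ : ℍ[ℝ] := ⟨0, 0, 1, 0⟩

/-- The quaternionic unit `k = i j`. -/
def unitK : ℍ[ℝ] := ⟨0, 0, 0, 1⟩

/-- The Wirtinger derivative `∂f/∂z̄₁`; on `f = f₁ + f₂ j` it acts on the two complex components,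
because complex numbers multiply from the left. -/
def dbar₁ (f : ℍ[ℝ] → ℍ[ℝ]) (q : ℍ[ℝ]) : ℍ[ℝ] :=
  (1 / 2 : ℝ) • (fderiv ℝ f q 1 + unitI * fderiv ℝ f q unitI)

/-- The Wirtinger derivative `∂f/∂z̄₂`. -/
def dbar₂ (f : ℍ[ℝ] → ℍ[ℝ]) (q : ℍ[ℝ]) : ℍ[ℝ] :=
  (1 / 2 : ℝ) • (fderiv ℝ f q unitJ + unitI * fderiv ℝ f q unitK)

/-- The modified Cauchy-Fueter operator `𝒟 = ½ (∂/∂z̄₁ + j ∂/∂z̄₂)`. -/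
def cauchyFueter (f : ℍ[ℝ] → ℍ[ℝ]) (q : ℍ[ℝ]) : ℍ[ℝ] :=
  (1 / 2 : ℝ) • (dbar₁ f q + unitJ * dbar₂ f q)

/-- `f` is hyperholomorphic on the open set `U`: it is `C^∞` there and `𝒟 f = 0`. -/
def IsHyperholomorphicOn (f : ℍ[ℝ] → ℍ[ℝ]) (U : Set ℍ[ℝ]) : Prop :=
  ContDiffOn ℝ ∞ f U ∧ ∀ q ∈ U, cauchyFueter f q = 0

/-- A `C^∞` (embedded) real hypersurface of `ℍ`: near each of its points it is the zero set of
a `C^∞` real function without critical points. -/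
def IsSmoothHypersurface (H : Set ℍ[ℝ]) : Prop :=
  ∀ p ∈ H, ∃ V : Set ℍ[ℝ], IsOpen V ∧ p ∈ V ∧ ∃ ρ : ℍ[ℝ] → ℝ,
    ContDiffOn ℝ ∞ ρ V ∧ (∀ q ∈ V, fderiv ℝ ρ q ≠ 0) ∧ H ∩ V = {q | q ∈ V ∧ ρ q = 0}

/-- `S` is an exceptional subset of the open set `U`: it is closed in `U` and contained in the
union of a family of `C^∞` hypersurfaces which is locally finite in `U`.  A function is defined
almost everywhere on `U` if it is defined outside such a set. -/
def IsExceptional (S U : Set ℍ[ℝ]) : Prop :=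
  S ⊆ U ∧ IsOpen (U \ S) ∧ ∃ 𝓗 : Set (Set ℍ[ℝ]),
    (∀ H ∈ 𝓗, IsSmoothHypersurface H) ∧ S ⊆ ⋃₀ 𝓗 ∧
    ∀ p ∈ U, ∃ V ∈ 𝓝 p, {H | H ∈ 𝓗 ∧ (H ∩ V).Nonempty}.Finite

/-- `f` is w-hypermeromorphic on `U`: it is an almost everywhere defined hyperholomorphic function
whose inverse is, where it is defined, hyperholomorphic almost everywhere.  The values of `f` on
the exceptional set are irrelevant. -/
def IsWHypermeromorphicOn (f : ℍ[ℝ] → ℍ[ℝ]) (U : Set ℍ[ℝ]) : Prop :=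
  ∃ S : Set ℍ[ℝ], IsExceptional S U ∧ IsHyperholomorphicOn f (U \ S) ∧
    IsHyperholomorphicOn (fun q => (f q)⁻¹) {q | q ∈ U \ S ∧ f q ≠ 0}

/-- `f` is hypermeromorphic on `U`: it belongs to a space of w-hypermeromorphic functions on `U`
in which sums and products are again w-hypermeromorphic. -/
def IsHypermeromorphicOn (f : ℍ[ℝ] → ℍ[ℝ]) (U : Set ℍ[ℝ]) : Prop :=
  ∃ A : Set (ℍ[ℝ] → ℍ[ℝ]), f ∈ A ∧ (∀ g ∈ A, IsWHypermeromorphicOn g U) ∧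
    ∀ g ∈ A, ∀ h ∈ A, g + h ∈ A ∧ g * h ∈ A

/-- `f` is pseudoholomorphic on `U`: it is hypermeromorphic without poles on `U`, that is,
it is hyperholomorphic on the whole of `U`. -/
def IsPseudoholomorphicOn (f : ℍ[ℝ] → ℍ[ℝ]) (U : Set ℍ[ℝ]) : Prop :=
  IsHypermeromorphicOn f U ∧ IsHyperholomorphicOn f U

/-- `f` is a smooth hypermeromorphic (sha) function on `U`: it is hypermeromorphic without zeroes
and without poles on `U`. -/
def IsShaOn (f : ℍ[ℝ] → ℍ[ℝ]) (U : Set ℍ[ℝ]) : Prop :=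
  IsPseudoholomorphicOn f U ∧ ∀ q ∈ U, f q ≠ 0

/-- A Hamilton 4-manifold: a Hausdorff space with an atlas of charts in `ℍ` such that the
transition function between any two different charts of the atlas is a sha function. -/
class IsHamiltonManifold (X : Type*) [TopologicalSpace X] [ChartedSpace ℍ[ℝ] X] : Prop
    extends T2Space X where
  isSha_transition : ∀ e ∈ atlas ℍ[ℝ] X, ∀ e' ∈ atlas ℍ[ℝ] X, e ≠ e' →
    IsShaOn (e' ∘ e.symm) (e.symm.trans e').source

/-- The pseudoholomorphic charts `(h, U)` of `X`: the charts of the atlas and their restrictions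
to open subsets. -/
def IsPseudoholomorphicChart {X : Type*} [TopologicalSpace X] [ChartedSpace ℍ[ℝ] X]
    (c : OpenPartialHomeomorph X ℍ[ℝ]) : Prop :=
  ∃ e ∈ atlas ℍ[ℝ] X, c.source ⊆ e.source ∧ EqOn c e c.source

/-- Pseudoholomorphic maps (morphisms) `f : X → Y`: `f` is continuous and, for all pseudoholomorphic
charts `(h, U)` of `X` and `(k, V)` of `Y` with `f(U) ⊆ V`, the function `k ∘ f ∘ h⁻¹` is
pseudoholomorphic on `h(U)`. -/
def IsMorphism {X Y : Type*} [TopologicalSpace X] [ChartedSpace ℍ[ℝ] X]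
    [TopologicalSpace Y] [ChartedSpace ℍ[ℝ] Y] (f : X → Y) : Prop :=
  Continuous f ∧ ∀ (h : OpenPartialHomeomorph X ℍ[ℝ]) (k : OpenPartialHomeomorph Y ℍ[ℝ]),
    IsPseudoholomorphicChart h → IsPseudoholomorphicChart k → MapsTo f h.source k.source →
      IsPseudoholomorphicOn (k ∘ f ∘ h.symm) h.target

end Hamilton

end

/-! By connectedness it suffices that the open set where `f₁` and `f₂` agree locally is closed. In
charts this is unique continuation for 𝒟 on a ball: a solution vanishing near the centre vanishes
throughout.

The analytic core avoids power series. On solutions of 𝒟 u = 0 the Euler field E = Σ x_b ∂_b is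
symmetric for ∫ w ⟨u, v⟩ with w radial (`integral_radialBump_euler`), because w(⟨u, Ev⟩ - ⟨Eu, v⟩)
is the divergence of a compactly supported field. Dilations are the flow of E and preserve
solutions, so ∫ w(x) ⟨f(e^(α-t) x), f(e^(α+t) x)⟩ dx does not depend on t. It vanishes at t = h if f
= 0 on the ball of radius e^(α-h), and at t = 0 it is a weighted L² norm of f on the ball of radius
e^α (`eq_zero_of_three_balls`). Vanishing thus spreads from radius ρ to √(ρR), hence up to R. -/

namespace Hamilton

open MeasureTheory

/-! ### Integration by parts and differentiation under the integral -/

section Integration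

variable {E : Type*} [NormedAddCommGroup E] [NormedSpace ℝ E] [FiniteDimensional ℝ E]
  [MeasurableSpace E] [BorelSpace E] (μ : Measure E) [μ.IsAddHaarMeasure]

/-- The integral of a directional derivative of a compactly supported function vanishes. -/
theorem integral_fderiv_eq_zero {F : E → ℝ} (hF : ContDiff ℝ 1 F) (hc : HasCompactSupport F)
    (v : E) : ∫ x, fderiv ℝ F x v ∂μ = 0 := by
  have h1 : Integrable F μ := hF.continuous.integrable_of_hasCompactSupport hc
  have h2 : Integrable (fun x => fderiv ℝ F x v) μ :=
    ((hF.continuous_fderiv one_ne_zero).clm_apply continuous_const).integrable_of_hasCompactSupport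
      (hc.fderiv_apply ℝ v)
  -- Integration by parts against the constant 1.
  have h := integral_mul_fderiv_eq_neg_fderiv_mul_of_integrable (μ := μ) (v := v)
    (f := fun _ : E => (1 : ℝ)) (g := F) (by simp) (by simpa using h2) (by simpa using h1)
    (fun x _ => differentiableAt_const _) (fun x _ => hF.differentiable one_ne_zero x)
  simpa using h

/-- Differentiation under the integral sign for a `C¹` family of functions supported in the
unit ball. -/
theorem hasDerivAt_integral_of_contDiff {Φ Φ' : ℝ → E → ℝ}
    (hΦ : ∀ t, Continuous (Φ t)) (hΦ' : Continuous fun p : ℝ × E => Φ' p.1 p.2)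
    (hder : ∀ t x, HasDerivAt (fun s => Φ s x) (Φ' t x) t)
    (h0 : ∀ t x, 1 ≤ ‖x‖ → Φ t x = 0) (h0' : ∀ t x, 1 ≤ ‖x‖ → Φ' t x = 0) (t : ℝ) :
    HasDerivAt (fun s => ∫ x, Φ s x ∂μ) (∫ x, Φ' t x ∂μ) t := by
  obtain ⟨C, hC⟩ := ((isCompact_Icc (a := t - 1) (b := t + 1)).prod
    (isCompact_closedBall (0 : E) 1)).exists_bound_of_continuousOn hΦ'.continuousOn
  have hsupp : HasCompactSupport (Φ t) := by
    refine HasCompactSupport.intro (isCompact_closedBall (0 : E) 1) fun x hx => h0 t x ?_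
    simp at hx
    exact hx.le
  refine (hasDerivAt_integral_of_dominated_loc_of_deriv_le (F := Φ) (F' := Φ') (μ := μ)
    (s := Icc (t - 1) (t + 1)) (bound := (Metric.closedBall (0 : E) 1).indicator fun _ => C)
    (Icc_mem_nhds (by linarith) (by linarith))
    (Eventually.of_forall fun s => (hΦ s).aestronglyMeasurable)
    ((hΦ t).integrable_of_hasCompactSupport hsupp)
    (hΦ'.comp (Continuous.prodMk continuous_const continuous_id)).aestronglyMeasurable
    (Eventually.of_forall fun x s hs => ?_) ?_
    (Eventually.of_forall fun x s _ => hder s x)).2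
  · by_cases hx : x ∈ Metric.closedBall (0 : E) 1
    · rw [indicator_of_mem hx]
      exact hC (s, x) ⟨hs, hx⟩
    · rw [indicator_of_notMem hx, h0' s x (by simp at hx; exact hx.le), norm_zero]
  · refine (integrable_indicator_iff Metric.isClosed_closedBall.measurableSet).2 ?_
    exact integrableOn_const (isCompact_closedBall _ _).measure_lt_top.ne

end Integration

/-! ### The radial weight -/

/-- A smooth radial function which is positive exactly on the open unit ball. -/
noncomputable def radialBump (x : ℍ[ℝ]) : ℝ := Real.smoothTransition (1 - ‖x‖ ^ 2)

theorem contDiff_radialBump : ContDiff ℝ 1 radialBump :=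
  Real.smoothTransition.contDiff.comp (contDiff_const.sub (contDiff_norm_sq ℝ))

theorem radialBump_eq_zero {x : ℍ[ℝ]} (hx : 1 ≤ ‖x‖) : radialBump x = 0 :=
  Real.smoothTransition.zero_of_nonpos (by nlinarith)

theorem radialBump_pos {x : ℍ[ℝ]} (hx : ‖x‖ < 1) : 0 < radialBump x :=
  Real.smoothTransition.pos_of_pos (by nlinarith [norm_nonneg x])

theorem hasCompactSupport_of_norm {F : ℍ[ℝ] → ℝ} (h : ∀ x, 1 ≤ ‖x‖ → F x = 0) :
    HasCompactSupport F := by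
  refine HasCompactSupport.intro (isCompact_closedBall (0 : ℍ[ℝ]) 1) fun x hx => h x ?_
  simp at hx
  exact hx.le

/-- The gradient of the weight is parallel to x, so it is orthogonal to a flux tangent to spheres.
-/
theorem fderiv_radialBump (x v : ℍ[ℝ]) : fderiv ℝ radialBump x v =
    -2 * deriv Real.smoothTransition (1 - ‖x‖ ^ 2) * inner ℝ x v := by
  have h1 : HasFDerivAt (fun y : ℍ[ℝ] => 1 - ‖y‖ ^ 2) (-(2 • (innerSL ℝ x))) x := by
    simpa using (hasStrictFDerivAt_norm_sq x).hasFDerivAt.const_sub 1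
  have h2 : HasDerivAt Real.smoothTransition (deriv Real.smoothTransition (1 - ‖x‖ ^ 2))
      (1 - ‖x‖ ^ 2) :=
    ((Real.smoothTransition.contDiff (n := 1)).differentiable one_ne_zero _).hasDerivAt
  have h3 : HasFDerivAt radialBump _ x := h2.comp_hasFDerivAt x h1
  rw [h3.fderiv]
  simp
  ring

/-! ### The Cauchy-Fueter equation and symmetry of the Euler field -/

@[simp] theorem unitI_re : unitI.re = 0 := rfl
@[simp] theorem unitI_imI : unitI.imI = 1 := rfl
@[simp] theorem unitI_imJ : unitI.imJ = 0 := rfl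
@[simp] theorem unitI_imK : unitI.imK = 0 := rfl
@[simp] theorem unitJ_re : unitJ.re = 0 := rfl
@[simp] theorem unitJ_imI : unitJ.imI = 0 := rfl
@[simp] theorem unitJ_imJ : unitJ.imJ = 1 := rfl
@[simp] theorem unitJ_imK : unitJ.imK = 0 := rfl
@[simp] theorem unitK_re : unitK.re = 0 := rfl
@[simp] theorem unitK_imI : unitK.imI = 0 := rfl
@[simp] theorem unitK_imJ : unitK.imJ = 0 := rfl
@[simp] theorem unitK_imK : unitK.imK = 1 := rfl

/-- The vanishing of the Cauchy-Fueter operator as an equation between the partial derivatives. -/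
theorem cauchyFueter_eq_zero_iff {f : ℍ[ℝ] → ℍ[ℝ]} {q : ℍ[ℝ]} : cauchyFueter f q = 0 ↔
    fderiv ℝ f q 1 = -(unitI * fderiv ℝ f q unitI) - unitJ * fderiv ℝ f q unitJ
      + unitK * fderiv ℝ f q unitK := by
  have : cauchyFueter f q = (1 / 4 : ℝ) • (fderiv ℝ f q 1 - (-(unitI * fderiv ℝ f q unitI)
      - unitJ * fderiv ℝ f q unitJ + unitK * fderiv ℝ f q unitK)) := by
    ext <;> simp [cauchyFueter, dbar₁, dbar₂] <;> ring
  rw [this, smul_eq_zero, sub_eq_zero]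
  norm_num

/-- The conjugate of `x` after reversing the sign of its `k` component. -/
noncomputable def twistedConj (x : ℍ[ℝ]) : ℍ[ℝ] := ⟨x.re, -x.imI, -x.imJ, x.imK⟩

@[simp] theorem twistedConj_re (x : ℍ[ℝ]) : (twistedConj x).re = x.re := rfl
@[simp] theorem twistedConj_imI (x : ℍ[ℝ]) : (twistedConj x).imI = -x.imI := rfl
@[simp] theorem twistedConj_imJ (x : ℍ[ℝ]) : (twistedConj x).imJ = -x.imJ := rfl
@[simp] theorem twistedConj_imK (x : ℍ[ℝ]) : (twistedConj x).imK = x.imK := rfl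

/-- The coefficient `x ↦ x' e - ⟨x, b⟩` of a flux, where `x'` is the twisted conjugate of `x`. -/
noncomputable def fluxCoeff (e b x : ℍ[ℝ]) : ℍ[ℝ] :=
  twistedConj x * e - (inner ℝ x b : ℝ) • (1 : ℍ[ℝ])

theorem inner_eq (p q : ℍ[ℝ]) :
    inner ℝ p q = p.re * q.re + p.imI * q.imI + p.imJ * q.imJ + p.imK * q.imK := by
  rw [Quaternion.inner_def]; simp

/-- `fluxCoeff` as a continuous linear map. -/
noncomputable def fluxCoeffL (e b : ℍ[ℝ]) : ℍ[ℝ] →L[ℝ] ℍ[ℝ] :=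
  LinearMap.toContinuousLinearMap
    { toFun := fluxCoeff e b
      map_add' := fun x y => by ext <;> simp [fluxCoeff, inner_eq] <;> ring
      map_smul' := fun c x => by ext <;> simp [fluxCoeff, inner_eq] <;> ring }

/-- The component in the direction `b` of the vector field whose divergence measures the asymmetry
of the Euler field. -/
noncomputable def flux (e b : ℍ[ℝ]) (u v : ℍ[ℝ] → ℍ[ℝ]) (x : ℍ[ℝ]) : ℝ :=
  radialBump x * inner ℝ (fluxCoeffL e b x * u x) (v x)

theorem contDiff_flux {u v : ℍ[ℝ] → ℍ[ℝ]} (hu : ContDiff ℝ 1 u) (hv : ContDiff ℝ 1 v)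
    (e b : ℍ[ℝ]) : ContDiff ℝ 1 (flux e b u v) :=
  contDiff_radialBump.mul (((fluxCoeffL e b).contDiff.mul hu).inner ℝ hv)

theorem fderiv_flux {u v : ℍ[ℝ] → ℍ[ℝ]} (hu : ContDiff ℝ 1 u) (hv : ContDiff ℝ 1 v)
    (e b x : ℍ[ℝ]) : fderiv ℝ (flux e b u v) x b =
      fderiv ℝ radialBump x b * inner ℝ (fluxCoeff e b x * u x) (v x)
      + radialBump x * (inner ℝ (fluxCoeff e b b * u x + fluxCoeff e b x * fderiv ℝ u x b) (v x)
        + inner ℝ (fluxCoeff e b x * u x) (fderiv ℝ v x b)) := by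
  have hw := (contDiff_radialBump.differentiable one_ne_zero x).hasFDerivAt
  have hu' := (hu.differentiable one_ne_zero x).hasFDerivAt
  have hv' := (hv.differentiable one_ne_zero x).hasFDerivAt
  have h : HasFDerivAt (flux e b u v) _ x :=
    hw.mul ((((fluxCoeffL e b).hasFDerivAt (x := x)).mul' hu').inner ℝ hv')
  rw [h.fderiv]
  simp [fluxCoeffL, inner_add_left]
  ring

/-- The pointwise algebra behind `sum_fderiv_flux`: `p`, `q` are the values of two functions at `x`
and `uᵢ`, `vᵢ` their partial derivatives. -/
theorem flux_identity (w c : ℝ) (x p q u₀ u₁ u₂ u₃ v₀ v₁ v₂ v₃ : ℍ[ℝ])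
    (hu : w • u₀ = w • (-(unitI * u₁) - unitJ * u₂ + unitK * u₃))
    (hv : w • v₀ = w • (-(unitI * v₁) - unitJ * v₂ + unitK * v₃)) :
    (c * inner ℝ x 1 * inner ℝ (fluxCoeff 1 1 x * p) q
      + w * (inner ℝ (fluxCoeff 1 1 1 * p + fluxCoeff 1 1 x * u₀) q
        + inner ℝ (fluxCoeff 1 1 x * p) v₀))
    + (c * inner ℝ x unitI * inner ℝ (fluxCoeff unitI unitI x * p) q
      + w * (inner ℝ (fluxCoeff unitI unitI unitI * p + fluxCoeff unitI unitI x * u₁) q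
        + inner ℝ (fluxCoeff unitI unitI x * p) v₁))
    + (c * inner ℝ x unitJ * inner ℝ (fluxCoeff unitJ unitJ x * p) q
      + w * (inner ℝ (fluxCoeff unitJ unitJ unitJ * p + fluxCoeff unitJ unitJ x * u₂) q
        + inner ℝ (fluxCoeff unitJ unitJ x * p) v₂))
    + (c * inner ℝ x unitK * inner ℝ (fluxCoeff (-unitK) unitK x * p) q
      + w * (inner ℝ (fluxCoeff (-unitK) unitK unitK * p + fluxCoeff (-unitK) unitK x * u₃) q
        + inner ℝ (fluxCoeff (-unitK) unitK x * p) v₃))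
    = w * (inner ℝ p (x.re • v₀ + x.imI • v₁ + x.imJ • v₂ + x.imK • v₃)
        - inner ℝ (x.re • u₀ + x.imI • u₁ + x.imJ • u₂ + x.imK • u₃) q) := by
  -- Put e_b = 1, i, j, -k for b = 1, i, j, k, so the equation reads Σ e_b ∂_b u = 0, and x' is the
  -- conjugate of Σ x_b e_b. The `c` terms cancel since Σ x_b (x' e_b - x_b) = |x|² - |x|² = 0;
  -- `fluxCoeff e_b b b` = 0; the u-derivatives give -Eu. Moving x' e_b across the inner product
  -- turns it into 2x_b - x' e_b, so the v-derivatives give 2Ev - Ev.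
  rcases eq_or_ne w 0 with rfl | hw
  · simp only [inner_eq, fluxCoeff]
    simp
    ring
  · obtain rfl := smul_right_injective _ hw hu
    obtain rfl := smul_right_injective _ hw hv
    simp only [inner_eq, fluxCoeff]
    simp
    ring

/-- This exhibits the antisymmetric part of E as a divergence. The equations are needed only in the
unit ball because the weight vanishes outside it. -/
theorem sum_fderiv_flux {u v : ℍ[ℝ] → ℍ[ℝ]} (hu : ContDiff ℝ 1 u) (hv : ContDiff ℝ 1 v)
    {x : ℍ[ℝ]} (hDu : ‖x‖ < 1 → cauchyFueter u x = 0) (hDv : ‖x‖ < 1 → cauchyFueter v x = 0) :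
    fderiv ℝ (flux 1 1 u v) x 1 + fderiv ℝ (flux unitI unitI u v) x unitI
      + fderiv ℝ (flux unitJ unitJ u v) x unitJ + fderiv ℝ (flux (-unitK) unitK u v) x unitK
    = radialBump x * (inner ℝ (u x) (fderiv ℝ v x x) - inner ℝ (fderiv ℝ u x x) (v x)) := by
  have hx : x = x.re • (1 : ℍ[ℝ]) + x.imI • unitI + x.imJ • unitJ + x.imK • unitK := by
    ext <;> simp
  have key (L : ℍ[ℝ] →L[ℝ] ℍ[ℝ]) : L x = x.re • L 1 + x.imI • L unitI + x.imJ • L unitJ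
      + x.imK • L unitK := by
    conv_lhs => rw [hx]
    simp only [map_add, map_smul]
  simp only [fderiv_flux hu hv, key, fderiv_radialBump]
  apply flux_identity <;> by_cases h : ‖x‖ < 1
  · rw [cauchyFueter_eq_zero_iff.1 (hDu h)]
  · simp [radialBump_eq_zero (not_lt.1 h)]
  · rw [cauchyFueter_eq_zero_iff.1 (hDv h)]
  · simp [radialBump_eq_zero (not_lt.1 h)]

/-- The Euler field is symmetric on hyperholomorphic functions with respect to a radial weight. -/
theorem integral_radialBump_euler [MeasurableSpace ℍ[ℝ]] [BorelSpace ℍ[ℝ]] (μ : Measure ℍ[ℝ])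
    [μ.IsAddHaarMeasure] {u v : ℍ[ℝ] → ℍ[ℝ]} (hu : ContDiff ℝ 1 u) (hv : ContDiff ℝ 1 v)
    (hDu : ∀ x, ‖x‖ < 1 → cauchyFueter u x = 0) (hDv : ∀ x, ‖x‖ < 1 → cauchyFueter v x = 0) :
    ∫ x, radialBump x * (inner ℝ (u x) (fderiv ℝ v x x) - inner ℝ (fderiv ℝ u x x) (v x)) ∂μ
      = 0 := by
  have hc (e b : ℍ[ℝ]) : HasCompactSupport (flux e b u v) :=
    hasCompactSupport_of_norm fun x hx => by simp [flux, radialBump_eq_zero hx]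
  have hi (e b : ℍ[ℝ]) : Integrable (fun x => fderiv ℝ (flux e b u v) x b) μ :=
    (((contDiff_flux hu hv e b).continuous_fderiv one_ne_zero).clm_apply
      continuous_const).integrable_of_hasCompactSupport ((hc e b).fderiv_apply ℝ b)
  have h0 (e b : ℍ[ℝ]) := integral_fderiv_eq_zero μ (contDiff_flux hu hv e b) (hc e b) b
  simp_rw [← sum_fderiv_flux hu hv (hDu _) (hDv _)]
  have e1 := integral_add (hi 1 1) (hi unitI unitI)
  have e2 := integral_add ((hi 1 1).add (hi unitI unitI)) (hi unitJ unitJ)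
  have e3 := integral_add (((hi 1 1).add (hi unitI unitI)).add (hi unitJ unitJ)) (hi (-unitK) unitK)
  simp only [Pi.add_apply] at e1 e2 e3
  rw [e3, e2, e1]
  simp [h0]

/-! ### Dilations and the three-balls principle -/

theorem fderiv_comp_smul_apply {f : ℍ[ℝ] → ℍ[ℝ]} (hf : ContDiff ℝ 1 f) (c : ℝ) (x v : ℍ[ℝ]) :
    fderiv ℝ (fun y => f (c • y)) x v = c • fderiv ℝ f (c • x) v := by
  have h1 : HasFDerivAt (fun y : ℍ[ℝ] => c • y) (c • ContinuousLinearMap.id ℝ ℍ[ℝ]) x :=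
    (hasFDerivAt_id x).const_smul c
  have h2 := (hf.differentiable one_ne_zero (c • x)).hasFDerivAt.comp x h1
  have h3 : fderiv ℝ (fun y => f (c • y)) x = _ := h2.fderiv
  rw [h3]
  simp

theorem cauchyFueter_comp_smul {f : ℍ[ℝ] → ℍ[ℝ]} (hf : ContDiff ℝ 1 f) (c : ℝ) {x : ℍ[ℝ]}
    (h : cauchyFueter f (c • x) = 0) : cauchyFueter (fun y => f (c • y)) x = 0 := by
  rw [cauchyFueter_eq_zero_iff] at h ⊢
  simp only [fderiv_comp_smul_apply hf, h, mul_smul_comm, smul_add, smul_sub, smul_neg]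

theorem contDiff_comp_smul {f : ℍ[ℝ] → ℍ[ℝ]} (hf : ContDiff ℝ 1 f) (c : ℝ) :
    ContDiff ℝ 1 fun y => f (c • y) :=
  hf.comp (contDiff_const_smul c)

theorem hasDerivAt_comp_exp_smul {f : ℍ[ℝ] → ℍ[ℝ]} (hf : ContDiff ℝ 1 f) {g : ℝ → ℝ} {g' t : ℝ}
    (hg : HasDerivAt g g' t) (x : ℍ[ℝ]) :
    HasDerivAt (fun s => f (Real.exp (g s) • x))
      (g' • fderiv ℝ f (Real.exp (g t) • x) (Real.exp (g t) • x)) t := by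
  have h1 := (hg.exp.smul_const x)
  have h2 := (hf.differentiable one_ne_zero (Real.exp (g t) • x)).hasFDerivAt.comp_hasDerivAt t h1
  have h3 : g' • fderiv ℝ f (Real.exp (g t) • x) (Real.exp (g t) • x)
      = fderiv ℝ f (Real.exp (g t) • x) ((Real.exp (g t) * g') • x) := by
    rw [← map_smul, smul_smul, mul_comm]
  rw [h3]
  exact h2

/-- A Hadamard three-balls principle: a hyperholomorphic function on the ball of radius `exp (α + h)`
vanishing on the ball of radius `exp (α - h)` vanishes on the ball of radius `exp α`. -/
theorem eq_zero_of_three_balls {f : ℍ[ℝ] → ℍ[ℝ]} (hf : ContDiff ℝ 1 f) {α h : ℝ} (hh : 0 ≤ h)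
    (hD : ∀ x, ‖x‖ < Real.exp (α + h) → cauchyFueter f x = 0)
    (h0 : ∀ x, ‖x‖ < Real.exp (α - h) → f x = 0) {x : ℍ[ℝ]} (hx : ‖x‖ < Real.exp α) :
    f x = 0 := by
  let _ : MeasurableSpace ℍ[ℝ] := borel _
  have : BorelSpace ℍ[ℝ] := ⟨rfl⟩
  let μ : Measure ℍ[ℝ] := Measure.addHaar
  have norm_lt {a b : ℝ} {y : ℍ[ℝ]} (hab : a ≤ b) (hy : ‖y‖ < 1) :
      ‖Real.exp a • y‖ < Real.exp b := by
    rw [norm_smul, Real.norm_of_nonneg (Real.exp_pos _).le]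
    nlinarith [Real.exp_pos a, Real.exp_le_exp.2 hab, norm_nonneg y]
  -- Opposite dilations: the t-derivative produces E with opposite signs on the two factors, which
  -- is the integrand of `integral_radialBump_euler`.
  let Φ : ℝ → ℍ[ℝ] → ℝ := fun t y => radialBump y *
    inner ℝ (f (Real.exp (α - t) • y)) (f (Real.exp (α + t) • y))
  let Φ' : ℝ → ℍ[ℝ] → ℝ := fun t y => radialBump y *
    (inner ℝ (f (Real.exp (α - t) • y))
        (fderiv ℝ f (Real.exp (α + t) • y) (Real.exp (α + t) • y))
      - inner ℝ (fderiv ℝ f (Real.exp (α - t) • y) (Real.exp (α - t) • y))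
        (f (Real.exp (α + t) • y)))
  have hw := contDiff_radialBump.continuous
  have hfc := hf.continuous
  have hfd := hf.continuous_fderiv one_ne_zero
  have hΦ (t : ℝ) : Continuous (Φ t) := by fun_prop
  have hΦ' : Continuous fun p : ℝ × ℍ[ℝ] => Φ' p.1 p.2 := by fun_prop
  have hder (t : ℝ) (y : ℍ[ℝ]) : HasDerivAt (fun s => Φ s y) (Φ' t y) t := by
    have h1 := hasDerivAt_comp_exp_smul hf ((hasDerivAt_id t).const_sub α) y
    have h2 := hasDerivAt_comp_exp_smul hf ((hasDerivAt_id t).const_add α) y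
    have h3 := (h1.inner ℝ h2).const_mul (radialBump y)
    simp only [id, one_smul, neg_smul, inner_neg_left, ← sub_eq_add_neg] at h3
    exact h3
  have hG := hasDerivAt_integral_of_contDiff μ hΦ hΦ' hder
    (fun t y hy => by simp [Φ, radialBump_eq_zero hy])
    (fun t y hy => by simp [Φ', radialBump_eq_zero hy])
  have hG0 (t : ℝ) (ht : t ∈ Ico 0 h) : ∫ y, Φ' t y ∂μ = 0 := by
    have := integral_radialBump_euler μ (contDiff_comp_smul hf (Real.exp (α - t)))
      (contDiff_comp_smul hf (Real.exp (α + t)))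
      (fun y hy => cauchyFueter_comp_smul hf _ (hD _ (norm_lt (by linarith [ht.1, ht.2]) hy)))
      (fun y hy => cauchyFueter_comp_smul hf _ (hD _ (norm_lt (by linarith [ht.1, ht.2]) hy)))
    simpa only [fderiv_comp_smul_apply hf, ← map_smul] using this
  have hconst := constant_of_has_deriv_right_zero (f := fun t => ∫ y, Φ t y ∂μ) (a := 0) (b := h)
    (fun t _ => (hG t).continuousAt.continuousWithinAt)
    (fun t ht => by simpa [hG0 t ht] using (hG t).hasDerivWithinAt) h (right_mem_Icc.2 hh)
  have hh0 : Φ h = 0 := by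
    ext y
    by_cases hy : ‖y‖ < 1
    · simp [Φ, h0 _ (norm_lt le_rfl hy)]
    · simp [Φ, radialBump_eq_zero (not_lt.1 hy)]
  have hnonneg : 0 ≤ Φ 0 := fun y => by
    have : 0 ≤ radialBump y * ‖f (Real.exp α • y)‖ ^ 2 :=
      mul_nonneg (Real.smoothTransition.nonneg _) (sq_nonneg _)
    simpa [Φ] using this
  have hint : ∫ y, Φ 0 y ∂μ = 0 := by simpa [hh0] using hconst.symm
  have hΦ0 : Φ 0 = 0 := by
    have hi : Integrable (Φ 0) μ := (hΦ 0).integrable_of_hasCompactSupport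
      (hasCompactSupport_of_norm fun y hy => by simp [Φ, radialBump_eq_zero hy])
    exact (Continuous.ae_eq_iff_eq μ (hΦ 0) continuous_const).1
      ((integral_eq_zero_iff_of_nonneg hnonneg hi).1 hint)
  have hy : ‖(Real.exp α)⁻¹ • x‖ < 1 := by
    rw [norm_smul, norm_inv, Real.norm_of_nonneg (Real.exp_pos _).le, inv_mul_lt_iff₀ (Real.exp_pos _)]
    simpa using hx
  have := congrFun hΦ0 ((Real.exp α)⁻¹ • x)
  simpa [Φ, (radialBump_pos hy).ne', smul_smul, (Real.exp_pos α).ne'] using this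

/-- A hyperholomorphic function on a ball which vanishes near the centre vanishes identically. -/
theorem eq_zero_on_ball_of_contDiff {f : ℍ[ℝ] → ℍ[ℝ]} (hf : ContDiff ℝ 1 f) {R : ℝ}
    (hD : ∀ x, ‖x‖ < R → cauchyFueter f x = 0) (h0 : ∀ᶠ x in 𝓝 0, f x = 0) {x : ℍ[ℝ]}
    (hx : ‖x‖ < R) : f x = 0 := by
  let S : Set ℝ := {r | r ≤ R ∧ ∀ y, ‖y‖ < r → f y = 0}
  obtain ⟨ε, hε, h⟩ := Metric.eventually_nhds_iff.1 h0
  have hR : 0 < R := (norm_nonneg x).trans_lt hx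
  have hεS : min ε R ∈ S :=
    ⟨min_le_right _ _, fun y hy => h (by simpa using hy.trans_le (min_le_left _ _))⟩
  have hb : BddAbove S := ⟨R, fun r hr => hr.1⟩
  have hρ : 0 < sSup S := (lt_min hε hR).trans_le (le_csSup hb hεS)
  have hρR : sSup S ≤ R := csSup_le ⟨_, hεS⟩ fun r hr => hr.1
  have hS (y : ℍ[ℝ]) (hy : ‖y‖ < sSup S) : f y = 0 := by
    obtain ⟨r, hr, hyr⟩ := exists_lt_of_lt_csSup ⟨_, hεS⟩ hy
    exact hr.2 y hyr
  suffices R ≤ sSup S from hS x (hx.trans_le this)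
  have hlog := Real.log_le_log hρ hρR
  set a := Real.log (sSup S)
  set b := Real.log R
  have hb' : Real.exp ((a + b) / 2 + (b - a) / 2) = R := by
    rw [show (a + b) / 2 + (b - a) / 2 = b by ring, Real.exp_log hR]
  have ha' : Real.exp ((a + b) / 2 - (b - a) / 2) = sSup S := by
    rw [show (a + b) / 2 - (b - a) / 2 = a by ring, Real.exp_log hρ]
  -- The geometric mean of `sSup S` and R is again in `S`, so it is at most `sSup S`, which forces R
  -- ≤ `sSup S`.
  have hmem : Real.exp ((a + b) / 2) ∈ S := by
    refine ⟨?_, fun y hy => eq_zero_of_three_balls hf (α := (a + b) / 2) (h := (b - a) / 2)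
      (by linarith) (by rwa [hb']) (by rwa [ha']) hy⟩
    rw [← Real.exp_log hR]
    exact Real.exp_le_exp.2 (by linarith)
  have := le_csSup hb hmem
  rw [← Real.exp_log hρ, Real.exp_le_exp] at this
  exact (Real.log_le_log_iff hR hρ).1 (by linarith)

/-! ### Unique continuation on open sets -/

theorem cauchyFueter_congr {f g : ℍ[ℝ] → ℍ[ℝ]} {q : ℍ[ℝ]} (h : f =ᶠ[𝓝 q] g) :
    cauchyFueter f q = cauchyFueter g q := by
  simp only [cauchyFueter, dbar₁, dbar₂, h.fderiv_eq]

theorem cauchyFueter_comp_add {f : ℍ[ℝ] → ℍ[ℝ]} (c q : ℍ[ℝ]) :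
    cauchyFueter (fun y => f (c + y)) q = cauchyFueter f (c + q) := by
  simp only [cauchyFueter, dbar₁, dbar₂, fderiv_comp_add_left]

/-- Identity theorem on a ball, for vanishing near the centre. -/
theorem IsHyperholomorphicOn.eq_zero_on_ball {f : ℍ[ℝ] → ℍ[ℝ]} {c : ℍ[ℝ]} {R : ℝ}
    (hf : IsHyperholomorphicOn f (Metric.ball c R)) (h0 : ∀ᶠ x in 𝓝 c, f x = 0) {x : ℍ[ℝ]}
    (hx : x ∈ Metric.ball c R) : f x = 0 := by
  obtain ⟨r, hxr, hrR⟩ := exists_between (Metric.mem_ball.1 hx)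
  obtain ⟨R', hrR', hR'⟩ := exists_between hrR
  have hr : 0 < r := dist_nonneg.trans_lt hxr
  -- The integral argument needs a globally C¹ function. The cutoff is 1 up to radius r and 0 beyond
  -- R' < R, so nothing changes on the ball of radius r, which contains x - c.
  let χ : ContDiffBump (0 : ℍ[ℝ]) := ⟨r, R', hr, hrR'⟩
  let g : ℍ[ℝ] → ℍ[ℝ] := fun y => χ y • f (c + y)
  have hball (y : ℍ[ℝ]) (hy : ‖y‖ < R) : c + y ∈ Metric.ball c R := by simpa using hy
  have hg : ContDiff ℝ 1 g := by
    refine contDiff_iff_contDiffAt.2 fun y => ?_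
    rcases lt_or_ge ‖y‖ R with hy | hy
    · have h1 : ContDiffAt ℝ 1 f (c + y) :=
        ((hf.1.contDiffAt (Metric.isOpen_ball.mem_nhds (hball y hy))).of_le (by norm_cast))
      exact χ.contDiff.contDiffAt.smul (h1.comp y (contDiffAt_const.add contDiffAt_id))
    · have : g =ᶠ[𝓝 y] fun _ => 0 := by
        have : ∀ᶠ z in 𝓝 y, R' < ‖z‖ :=
          continuous_norm.continuousAt.eventually (lt_mem_nhds (hR'.trans_le hy))
        filter_upwards [this] with z hz
        simp [g, χ.zero_of_le_dist (x := z) (by simpa [χ] using hz.le)]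
      exact contDiffAt_const.congr_of_eventuallyEq this
  have hgf (y : ℍ[ℝ]) (hy : ‖y‖ < r) : g y = f (c + y) := by
    simp [g, χ.one_of_mem_closedBall (x := y) (by simpa [χ] using hy.le)]
  have hgD (y : ℍ[ℝ]) (hy : ‖y‖ < r) : cauchyFueter g y = 0 := by
    have : g =ᶠ[𝓝 y] fun z => f (c + z) := by
      filter_upwards [continuous_norm.continuousAt.eventually (gt_mem_nhds hy)] with z hz
        using hgf z hz
    rw [cauchyFueter_congr this, cauchyFueter_comp_add]
    exact hf.2 _ (hball y (hy.trans hrR))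
  have hg0 : ∀ᶠ y in 𝓝 0, g y = 0 := by
    have : Tendsto (fun y : ℍ[ℝ] => c + y) (𝓝 0) (𝓝 c) := by
      simpa using (continuous_const_add c).tendsto (0 : ℍ[ℝ])
    filter_upwards [this.eventually h0] with y hy
    simp [g, hy]
  have hxn : ‖x - c‖ < r := by rwa [← dist_eq_norm]
  have := eq_zero_on_ball_of_contDiff hg hgD hg0 hxn
  rwa [hgf _ hxn, add_sub_cancel] at this

theorem IsHyperholomorphicOn.mono {f : ℍ[ℝ] → ℍ[ℝ]} {U V : Set ℍ[ℝ]}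
    (hf : IsHyperholomorphicOn f U) (h : V ⊆ U) : IsHyperholomorphicOn f V :=
  ⟨hf.1.mono h, fun q hq => hf.2 q (h hq)⟩

theorem IsHyperholomorphicOn.sub {f g : ℍ[ℝ] → ℍ[ℝ]} {U : Set ℍ[ℝ]} (hU : IsOpen U)
    (hf : IsHyperholomorphicOn f U) (hg : IsHyperholomorphicOn g U) :
    IsHyperholomorphicOn (f - g) U := by
  refine ⟨hf.1.sub hg.1, fun q hq => ?_⟩
  have hf1 := (hf.1.contDiffAt (hU.mem_nhds hq)).differentiableAt (by simp)
  have hg1 := (hg.1.contDiffAt (hU.mem_nhds hq)).differentiableAt (by simp)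
  have hf2 := cauchyFueter_eq_zero_iff.1 (hf.2 q hq)
  have hg2 := cauchyFueter_eq_zero_iff.1 (hg.2 q hq)
  rw [cauchyFueter_eq_zero_iff, fderiv_sub hf1 hg1]
  simp only [_root_.sub_apply, hf2, hg2, mul_sub]
  abel

/-- If two hyperholomorphic functions on an open set agree near points arbitrarily close to `p`,
then they agree near `p`. -/
theorem IsHyperholomorphicOn.eventuallyEq_of_mem_closure {f g : ℍ[ℝ] → ℍ[ℝ]} {U : Set ℍ[ℝ]}
    (hU : IsOpen U) (hf : IsHyperholomorphicOn f U) (hg : IsHyperholomorphicOn g U) {p : ℍ[ℝ]}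
    (hp : p ∈ U) (hcl : p ∈ closure {c | f =ᶠ[𝓝 c] g}) : f =ᶠ[𝓝 p] g := by
  obtain ⟨ε, hε, hεU⟩ := Metric.isOpen_iff.1 hU p hp
  -- With ε / 2 the ball centred at c contains p and still lies in U.
  obtain ⟨c, hc, hpc⟩ := Metric.mem_closure_iff.1 hcl (ε / 2) (half_pos hε)
  have hsub : Metric.ball c (ε / 2) ⊆ U := (Metric.ball_subset_ball' (by
    rw [dist_comm]; linarith)).trans hεU
  filter_upwards [Metric.isOpen_ball.mem_nhds (Metric.mem_ball.2 hpc)] with x hx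
  have := ((hf.sub hU hg).mono hsub).eq_zero_on_ball (by
    filter_upwards [hc] with y hy
    simp [hy]) hx
  simpa [sub_eq_zero] using this

/-! ### Transfer to morphisms -/

theorem IsPseudoholomorphicChart.restr {X : Type*} [TopologicalSpace X] [ChartedSpace ℍ[ℝ] X]
    {e : OpenPartialHomeomorph X ℍ[ℝ]} (he : e ∈ atlas ℍ[ℝ] X) (s : Set X) :
    IsPseudoholomorphicChart (e.restr s) :=
  ⟨e, he, inter_subset_left, fun _ _ => rfl⟩

/-- Two morphisms which agree near points arbitrarily close to `x` agree near `x`. -/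
theorem IsMorphism.eventuallyEq_of_mem_closure {X Y : Type*}
    [TopologicalSpace X] [ChartedSpace ℍ[ℝ] X]
    [TopologicalSpace Y] [ChartedSpace ℍ[ℝ] Y] [T2Space Y]
    {f₁ f₂ : X → Y} (hf₁ : IsMorphism f₁) (hf₂ : IsMorphism f₂) {x : X}
    (hx : x ∈ closure {y | f₁ =ᶠ[𝓝 y] f₂}) : f₁ =ᶠ[𝓝 x] f₂ := by
  -- Equality at the limit point, from Y being Hausdorff, lets a single chart of Y serve both maps
  -- near x.
  have hfx : f₁ x = f₂ x :=
    closure_minimal (fun y (hy : f₁ =ᶠ[𝓝 y] f₂) => hy.eq_of_nhds)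
      (isClosed_eq hf₁.1 hf₂.1) hx
  let k := chartAt ℍ[ℝ] (f₁ x)
  let s : Set X := f₁ ⁻¹' k.source ∩ f₂ ⁻¹' k.source
  have hs : IsOpen s := (k.open_source.preimage hf₁.1).inter (k.open_source.preimage hf₂.1)
  have hxs : x ∈ s := ⟨mem_chart_source _ _, by
    change f₂ x ∈ k.source
    rw [← hfx]
    exact mem_chart_source _ _⟩
  let h := (chartAt ℍ[ℝ] x).restr s
  have hsrc : h.source = (chartAt ℍ[ℝ] x).source ∩ s := OpenPartialHomeomorph.restr_source' _ _ hs
  have hxh : x ∈ h.source := hsrc ▸ ⟨mem_chart_source _ _, hxs⟩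
  have hh : IsPseudoholomorphicChart h := .restr (chart_mem_atlas _ _) s
  have hk : IsPseudoholomorphicChart k := ⟨k, chart_mem_atlas _ _, Subset.rfl, fun _ _ => rfl⟩
  have hm₁ : MapsTo f₁ h.source k.source := fun y hy => (hsrc ▸ hy).2.1
  have hm₂ : MapsTo f₂ h.source k.source := fun y hy => (hsrc ▸ hy).2.2
  have key : k ∘ f₁ ∘ h.symm =ᶠ[𝓝 (h x)] k ∘ f₂ ∘ h.symm := by
    refine (hf₁.2 h k hh hk hm₁).2.eventuallyEq_of_mem_closure h.open_target
      (hf₂.2 h k hh hk hm₂).2 (h.map_source hxh) ?_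
    refine mem_closure_iff_nhds.2 fun t ht => ?_
    have ht' := inter_mem ((h.continuousAt hxh).preimage_mem_nhds ht) (h.open_source.mem_nhds hxh)
    obtain ⟨y, ⟨hyt, hyh⟩, hy⟩ := mem_closure_iff_nhds.1 hx _ ht'
    refine ⟨h y, hyt, ?_⟩
    filter_upwards [(h.tendsto_symm hyh).eventually hy] with z hz
    simp [hz]
  filter_upwards [(h.continuousAt hxh).eventually key, h.open_source.mem_nhds hxh] with y hy hyh
  refine k.injOn (hm₁ hyh) (hm₂ hyh) ?_
  simpa [h.left_inv hyh] using hy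

end Hamilton

theorem mainTheorem7 {X Y : Type*}
    [TopologicalSpace X] [ChartedSpace ℍ[ℝ] X] [Hamilton.IsHamiltonManifold X] [ConnectedSpace X]
    [TopologicalSpace Y] [ChartedSpace ℍ[ℝ] Y] [Hamilton.IsHamiltonManifold Y]
    (f₁ f₂ : X → Y) (hf₁ : Hamilton.IsMorphism f₁) (hf₂ : Hamilton.IsMorphism f₂)
    (x₀ : X) (hx₀ : ∃ N ∈ 𝓝 x₀, ∀ x ∈ N, f₁ x = f₂ x) :
    ∀ x : X, f₁ x = f₂ x := by
  have hopen : IsOpen {y | f₁ =ᶠ[𝓝 y] f₂} := isOpen_setOfPred_eventually_nhds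
  have hclosed : IsClosed {y | f₁ =ᶠ[𝓝 y] f₂} :=
    isClosed_of_closure_subset fun _ hx => hf₁.eventuallyEq_of_mem_closure hf₂ hx
  obtain ⟨N, hN, h⟩ := hx₀
  have huniv := IsClopen.eq_univ ⟨hclosed, hopen⟩ ⟨x₀, mem_of_superset hN h⟩
  intro x
  have hx : f₁ =ᶠ[𝓝 x] f₂ := huniv.ge (mem_univ x)
  exact hx.eq_of_nhds
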